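/- Let $f:\mathbb{R}^d\to\mathbb{R}^K$, $d\ge 2$, be a ReLU network with $L$ hidden layers of widths $n_1,\dots,n_L$ ($n_0=d$, $n_{L+1}=K$): with $\sigma(t)=\max\{0,t\}$ applied componentwise and $f^{(0)}(x)=x$, $$g^{(l)}(x)=W^{(l)}f^{(l-1)}(x)+b^{(l)}\quad(1\le l\le L+1),\qquad f^{(l)}(x)=\sigma(g^{(l)}(x))\quad(1\le l\le L),\qquad f(x)=g^{(L+1)}(x),$$ where $W^{(l)}\in\mathbb{R}^{n_l\times n_{l-1}}$ and $b^{(l)}\in\mathbb{R}^{n_l}$. Fix $x\in\mathbb{R}^d$. Let $\Sigma^{(l)}$ be the diagonal matrix with $\Sigma^{(l)}_{ii}=1$ if $g^{(l)}_i(x)>0$ and $0$ otherwise, and define $V^{(1)}=W^{(1)}$, $a^{(1)}=b^{(1)}$ and $$V^{(l+1)}=W^{(l+1)}\Sigma^{(l)}V^{(l)},\qquad a^{(l+1)}=W^{(l+1)}\Sigma^{(l)}a^{(l)}+b^{(l+1)}\qquad(1\le l\le L),$$ so that $g^{(l)}(z)=V^{(l)}z+a^{(l)}$ for $z$ in the linear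 region of $x$. Let $V^{(l)}_j$ denote the $j$-th row of $V^{(l)}$. Let $c$ be the correct class of $x$, and assume that $x$ is correctly classified, i.e. $f_s(x)<f_c(x)$ for all $s\ne c$. For $p\in[1,\infty]$ and $\frac1p+\frac1q=1$ define $$d^B_p(x)=\min_{1\le l\le L,\ 1\le j\le n_l,\ V^{(l)}_j\ne 0}\frac{|\langle V^{(l)}_j,x\rangle+a^{(l)}_j|}{\|V^{(l)}_j\|_q},\qquad d^D_p(x)=\min_{s\ne c,\ V^{(L+1)}_c\ne V^{(L+1)}_s}\frac{f_c(x)-f_s(x)}{\|V^{(L+1)}_c-V^{(L+1)}_s\|_q},$$ the minimal $l_p$-distances of $x$ to the hyperplanes bounding its linear region and to the decision hyperplanes (a minimum over the empty set is $+\infty$), and set $\rho_1=\min\{d^B_1(x),|d^D_1(x)|\}$ and $\rho_\infty=\min\{d^B_\infty(x),|d^D_\infty(x)|\}$. For a set $S\subseteq\mathbb{R}^d$ of admissible inputs, the $l_p$-robustness of $f$ at $x$ is $$\mathbf r_p(x)=\inf\Big\{\|\delta\|_p \;:\; \delta\in\mathbb{R}^d,\ x+\delta\in S,\ \max_{s\ne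 c}f_s(x+\delta)\ge f_c(x+\delta)\Big\}\in[0,\infty].$$ Then for every $S\subseteq\mathbb{R}^d$ and every $p\in(1,\infty)$, with $\frac1p+\frac1q=1$: if $\rho_1$ and $\rho_\infty$ are finite, then $$\mathbf r_p(x)\ \ge\ \frac{\rho_1}{\left(\rho_1/\rho_\infty-\alpha+\alpha^{q}\right)^{1/q}},\qquad \alpha=\frac{\rho_1}{\rho_\infty}-\Big\lfloor\frac{\rho_1}{\rho_\infty}\Big\rfloor,$$ where the right-hand side is read as $0$ if $\rho_1=\rho_\infty=0$; and if $\rho_1$ or $\rho_\infty$ is infinite (there are no hyperplanes at all), then $\mathbf r_p(x)=\infty$. -/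

import Mathlib

open scoped ENNReal Matrix

noncomputable section

/-- A fully connected feedforward network with `depth` hidden layers.  The layers are numbered
from `0`: `W l`, `b l` are the weight matrix and the bias that lead from layer `l` (with
`width l` units) to layer `l + 1`.  Layer `0` is the input and layer `depth + 1` is the output;
only `W l`, `b l` with `l ≤ depth` are used, further entries play no role. -/
structure ReLUNetwork where
  depth : ℕ
  width : ℕ → ℕ
  W : (l : ℕ) → Matrix (Fin (width (l + 1))) (Fin (width l)) ℝ
  b : (l : ℕ) → Fin (width (l + 1)) → ℝ

namespace ReLUNetwork

/-- The dimension of the input space. -/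
abbrev inputDim (N : ReLUNetwork) : ℕ := N.width 0

/-- The number of classes. -/
abbrev numClasses (N : ReLUNetwork) : ℕ := N.width (N.depth + 1)

/-- The output of layer `l` after the activation `t ↦ max 0 t`; layer `0` is the input. -/
def act (N : ReLUNetwork) (x : Fin N.inputDim → ℝ) : (l : ℕ) → Fin (N.width l) → ℝ
  | 0 => x
  | l + 1 => fun i => max 0 ((N.W l *ᵥ act N x l + N.b l) i)

/-- The pre-activation of layer `l + 1`. -/
def preAct (N : ReLUNetwork) (x : Fin N.inputDim → ℝ) (l : ℕ) : Fin (N.width (l + 1)) → ℝ :=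
  N.W l *ᵥ N.act x l + N.b l

/-- The classifier `f : ℝ^d → ℝ^K` computed by the network (no activation on the output). -/
def output (N : ReLUNetwork) (x : Fin N.inputDim → ℝ) : Fin N.numClasses → ℝ :=
  N.preAct x N.depth

/-- The diagonal 0-1 matrix of the active units of layer `l + 1` at the input `x`. -/
def activePattern (N : ReLUNetwork) (x : Fin N.inputDim → ℝ) (l : ℕ) :
    Matrix (Fin (N.width (l + 1))) (Fin (N.width (l + 1))) ℝ :=
  Matrix.diagonal fun i => if 0 < N.preAct x l i then 1 else 0

/-- The linear part `V` of the affine map `z ↦ V z + a` with which the pre-activation of layer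
`l + 1` agrees on the linear region of `x`: the activation of each earlier layer is replaced by
its 0-1 pattern at `x`. -/
def linPart (N : ReLUNetwork) (x : Fin N.inputDim → ℝ) :
    (l : ℕ) → Matrix (Fin (N.width (l + 1))) (Fin N.inputDim) ℝ
  | 0 => N.W 0
  | l + 1 => N.W (l + 1) * (N.activePattern x l * linPart N x l)

/-- The constant part `a` of the affine map `z ↦ V z + a` with which the pre-activation of layer
`l + 1` agrees on the linear region of `x`. -/
def constPart (N : ReLUNetwork) (x : Fin N.inputDim → ℝ) :
    (l : ℕ) → Fin (N.width (l + 1)) → ℝ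
  | 0 => N.b 0
  | l + 1 => N.W (l + 1) *ᵥ (N.activePattern x l *ᵥ constPart N x l) + N.b (l + 1)

/-- The `l_p`-norm on `ℝ^d`, for `p ∈ [1, ∞]`. -/
def lpNorm {d : ℕ} (p : ℝ≥0∞) (v : Fin d → ℝ) : ℝ := ‖WithLp.toLp p v‖

/-- The `l_p`-distance `|⟨V_j, x⟩ + a_j| / ‖V_j‖_q` (with `1/p + 1/q = 1`) of `x` to the
hyperplane `⟨V_j, z⟩ + a_j = 0` of unit `j` of hidden layer `l + 1`. -/
def unitDist (N : ReLUNetwork) (p : ℝ≥0∞) (x : Fin N.inputDim → ℝ) (l : ℕ)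
    (j : Fin (N.width (l + 1))) : ℝ :=
  |N.linPart x l j ⬝ᵥ x + N.constPart x l j| / lpNorm p.conjExponent (N.linPart x l j)

/-- The signed `l_p`-distance of `x` to the decision hyperplane between the classes `c` and `s`. -/
def classDist (N : ReLUNetwork) (p : ℝ≥0∞) (x : Fin N.inputDim → ℝ)
    (c s : Fin N.numClasses) : ℝ :=
  (N.output x c - N.output x s) /
    lpNorm p.conjExponent (N.linPart x N.depth c - N.linPart x N.depth s)

/-- `d^B_p(x)`: the minimal `l_p`-distance of `x` to the hyperplanes that define its linear
region.  A unit with zero linear part defines no hyperplane and does not enter; the minimum over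
no hyperplanes is `∞`. -/
def boundaryDist (N : ReLUNetwork) (p : ℝ≥0∞) (x : Fin N.inputDim → ℝ) : ℝ≥0∞ :=
  ⨅ (l : Fin N.depth) (j : Fin (N.width (l + 1))) (_ : N.linPart x l j ≠ 0),
    ENNReal.ofReal (N.unitDist p x l j)

/-- `d^D_p(x)`: the minimal signed `l_p`-distance of `x`, of class `c`, to the decision
hyperplanes.  A class `s` whose linear part equals that of `c` defines no hyperplane and does not
enter; the minimum over no hyperplanes is `∞`. -/
def decisionDist (N : ReLUNetwork) (p : ℝ≥0∞) (x : Fin N.inputDim → ℝ)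
    (c : Fin N.numClasses) : EReal :=
  ⨅ (s : Fin N.numClasses) (_ : s ≠ c) (_ : N.linPart x N.depth c ≠ N.linPart x N.depth s),
    ((N.classDist p x c s : ℝ) : EReal)

/-- `ρ_p = min {d^B_p(x), |d^D_p(x)|}`. -/
def rho (N : ReLUNetwork) (p : ℝ≥0∞) (x : Fin N.inputDim → ℝ) (c : Fin N.numClasses) : ℝ≥0∞ :=
  min (N.boundaryDist p x) (N.decisionDist p x c).abs

/-- The decision of the classifier at `x` is `c`: `c` is the unique maximizer of `r ↦ f_r(x)`. -/
def CorrectlyClassified (N : ReLUNetwork) (x : Fin N.inputDim → ℝ) (c : Fin N.numClasses) :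
    Prop :=
  ∀ s, s ≠ c → N.output x s < N.output x c

/-- The `l_p`-robustness at `x`, of class `c`, with constraint set `S`: the infimum of `‖δ‖_p`
over the `δ` with `x + δ ∈ S` and `max_{s ≠ c} f_s(x + δ) ≥ f_c(x + δ)` (`∞` if there are none). -/
def robustness (N : ReLUNetwork) (S : Set (Fin N.inputDim → ℝ)) (p : ℝ≥0∞)
    (x : Fin N.inputDim → ℝ) (c : Fin N.numClasses) : ℝ≥0∞ :=
  ⨅ (δ : Fin N.inputDim → ℝ) (_ : x + δ ∈ S)
    (_ : ∃ s, s ≠ c ∧ N.output (x + δ) c ≤ N.output (x + δ) s), ENNReal.ofReal (lpNorm p δ)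

end ReLUNetwork

end

/-!
The function `g(x) = V x + a` of a unit, or `g = f_c - f_s` of a pair of classes, cannot vanish at
`x + δ` as long as `|⟨V, δ⟩| < |g(x)|`, and while no hidden unit changes sign the network is the
affine map with coefficients `linPart`, `constPart`
(`ReLUNetwork.preAct_add_of_abs_dotProduct_le`). So a bound on the robustness amounts to a
bound on `|⟨V, δ⟩|` for each hyperplane (`ReLUNetwork.not_misclassified`).

By definition of `ρ₁` and `ρ_∞` each hyperplane satisfies `‖V‖_∞ ≤ |g(x)| / ρ₁` and
`‖V‖₁ ≤ |g(x)| / ρ_∞`. Under these two constraints the convex function `∑ |V_i| ^ q` is largest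
when as many coordinates as possible have the maximal modulus `|g(x)| / ρ₁`, one takes up the
remainder, and the others vanish, so that
`∑ |V_i| ^ q ≤ (|g(x)| / ρ₁) ^ q * (⌊s⌋ + fract s ^ q)` with `s = ρ₁ / ρ_∞`
(`sum_rpow_le_floor_add_fract_rpow`). Hölder's inequality then gives `|⟨V, δ⟩| < |g(x)|` for every
`δ` whose `l_p`-norm is below the stated bound.
-/

/-! ### Sums of powers under an `l_∞` and an `l_1` constraint -/

/-- Spreading two numbers of `[0, 1]` apart, with their sum fixed, increases the sum of their
`q`-th powers; here one of them has reached the endpoint `1`. -/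
lemma rpow_add_rpow_le_one_add_rpow {q a u : ℝ} (hq : 1 ≤ q) (ha1 : a ≤ 1)
    (hu1 : u ≤ 1) (h : 1 ≤ a + u) : a ^ q + u ^ q ≤ 1 + (a + u - 1) ^ q := by
  rcases eq_or_lt_of_le (show a + u - 1 ≤ 1 by linarith) with hβ | hβ
  · have h1 : a = 1 := by linarith
    have h2 : u = 1 := by linarith
    subst h1 h2
    norm_num
  have hconv := convexOn_rpow hq
  have hpos : 0 < 2 - a - u := by linarith
  -- `a` and `u` are the two convex combinations of `1` and `a + u - 1` with swapped weights
  have e1 : (1 - u) / (2 - a - u) + (1 - a) / (2 - a - u) = 1 := by field_simp; ring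
  have h1 := hconv.2 (show (1 : ℝ) ∈ Set.Ici 0 by simp)
    (show a + u - 1 ∈ Set.Ici (0 : ℝ) from by simp only [Set.mem_Ici]; linarith)
    (div_nonneg (by linarith) hpos.le) (div_nonneg (by linarith) hpos.le) e1
  have h2 := hconv.2 (show (1 : ℝ) ∈ Set.Ici 0 by simp)
    (show a + u - 1 ∈ Set.Ici (0 : ℝ) from by simp only [Set.mem_Ici]; linarith)
    (div_nonneg (by linarith) hpos.le) (div_nonneg (by linarith) hpos.le)
    ((add_comm _ _).trans e1)
  simp only [smul_eq_mul, Real.one_rpow, mul_one] at h1 h2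
  have ea : (1 - u) / (2 - a - u) + (1 - a) / (2 - a - u) * (a + u - 1) = a := by
    field_simp; ring
  have eu : (1 - a) / (2 - a - u) + (1 - u) / (2 - a - u) * (a + u - 1) = u := by
    field_simp; ring
  rw [ea] at h1
  rw [eu] at h2
  have e3 : (1 - u) / (2 - a - u) = 1 - (1 - a) / (2 - a - u) := by linarith
  rw [e3] at h1 h2
  linarith

lemma rpow_add_floor_add_fract_rpow_le {q a u : ℝ} (hq : 1 ≤ q) (hu : 0 ≤ u) (hu1 : u ≤ 1) :
    u ^ q + (⌊a⌋ + Int.fract a ^ q) ≤ ⌊a + u⌋ + Int.fract (a + u) ^ q := by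
  have hfa := Int.fract_nonneg a
  have hfa1 := Int.fract_lt_one a
  have hdec := Int.floor_add_fract a
  by_cases h : Int.fract a + u < 1
  · have hfl : ⌊a + u⌋ = ⌊a⌋ := by
      rw [Int.floor_eq_iff]; constructor <;> linarith
    have hfr : Int.fract (a + u) = Int.fract a + u := by
      rw [Int.fract, hfl]; linarith
    rw [hfr, hfl]
    linarith [Real.add_rpow_le_rpow_add hfa hu hq]
  · have hfl : ⌊a + u⌋ = ⌊a⌋ + 1 := by
      rw [Int.floor_eq_iff]; push_cast; constructor <;> linarith
    have hfr : Int.fract (a + u) = Int.fract a + u - 1 := by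
      rw [Int.fract, hfl]; push_cast; linarith
    rw [hfr, hfl]
    push_cast
    linarith [rpow_add_rpow_le_one_add_rpow hq hfa1.le hu1 (not_lt.mp h)]

lemma floor_add_fract_rpow_mono {q a b : ℝ} (hq : 0 ≤ q) (h : a ≤ b) :
    (⌊a⌋ : ℝ) + Int.fract a ^ q ≤ ⌊b⌋ + Int.fract b ^ q := by
  rcases eq_or_lt_of_le (Int.floor_le_floor h) with hf | hf
  · have : Int.fract a ≤ Int.fract b := by
      rw [Int.fract, Int.fract, hf]; linarith
    rw [hf]
    gcongr
  · have h1 : (⌊a⌋ : ℝ) + 1 ≤ ⌊b⌋ := by exact_mod_cast hf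
    have h2 := Real.rpow_le_one (Int.fract_nonneg a) (Int.fract_lt_one a).le hq
    have h3 := Real.rpow_nonneg (Int.fract_nonneg b) q
    linarith

lemma sum_rpow_le_floor_add_fract_rpow {ι : Type*} (t : Finset ι) {q s : ℝ} (hq : 1 ≤ q)
    (u : ι → ℝ) (hu : ∀ i, 0 ≤ u i) (hu1 : ∀ i, u i ≤ 1) (hs : ∑ i ∈ t, u i ≤ s) :
    ∑ i ∈ t, u i ^ q ≤ ⌊s⌋ + Int.fract s ^ q := by
  classical
  refine le_trans ?_ (floor_add_fract_rpow_mono (by linarith) hs)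
  clear hs
  induction t using Finset.induction_on with
  | empty => simp [Real.zero_rpow (show q ≠ 0 by linarith)]
  | insert i t hi ih =>
    rw [Finset.sum_insert hi, Finset.sum_insert hi, add_comm (u i) (∑ _ ∈ t, _)]
    linarith [rpow_add_floor_add_fract_rpow_le (a := ∑ i ∈ t, u i) hq (hu i) (hu1 i)]

namespace ReLUNetwork

/-! ### The norms `l_1`, `l_∞` and `l_p` -/

lemma abs_le_lpNorm_top {d : ℕ} (v : Fin d → ℝ) (i : Fin d) : |v i| ≤ lpNorm ⊤ v :=
  PiLp.norm_apply_le (WithLp.toLp ⊤ v) i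

lemma lpNorm_one {d : ℕ} (v : Fin d → ℝ) : lpNorm 1 v = ∑ i, |v i| := by
  rw [lpNorm, PiLp.norm_eq_sum (by simp)]
  simp

lemma lpNorm_ofReal {d : ℕ} {p : ℝ} (hp : 0 < p) (v : Fin d → ℝ) :
    lpNorm (ENNReal.ofReal p) v = (∑ i, |v i| ^ p) ^ (1 / p) := by
  rw [lpNorm, PiLp.norm_eq_sum (by simpa [ENNReal.toReal_ofReal hp.le] using hp)]
  simp [ENNReal.toReal_ofReal hp.le]

lemma lpNorm_top_pos {d : ℕ} {v : Fin d → ℝ} (hv : v ≠ 0) : 0 < lpNorm ⊤ v := by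
  obtain ⟨i, hi⟩ := Function.ne_iff.mp hv
  exact (abs_pos.mpr hi).trans_le (abs_le_lpNorm_top v i)

lemma lpNorm_one_pos {d : ℕ} {v : Fin d → ℝ} (hv : v ≠ 0) : 0 < lpNorm 1 v := by
  obtain ⟨i, hi⟩ := Function.ne_iff.mp hv
  rw [lpNorm_one]
  exact (abs_pos.mpr hi).trans_le
    (Finset.single_le_sum (f := fun i => |v i|) (fun _ _ => abs_nonneg _) (Finset.mem_univ i))

lemma abs_dotProduct_le_lpNorm_mul {d : ℕ} {p q : ℝ} (h : p.HolderConjugate q)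
    (v δ : Fin d → ℝ) :
    |v ⬝ᵥ δ| ≤ lpNorm (ENNReal.ofReal p) δ * (∑ i, |v i| ^ q) ^ (1 / q) := by
  rw [lpNorm_ofReal h.pos]
  calc |v ⬝ᵥ δ| ≤ ∑ i, |v i * δ i| := Finset.abs_sum_le_sum_abs _ _
    _ = ∑ i, |δ i| * |v i| := by simp only [abs_mul, mul_comm]
    _ ≤ _ := by
      simpa using Real.inner_le_Lp_mul_Lq Finset.univ (fun i => |δ i|) (fun i => |v i|) h

/-- A hyperplane `⟨v, ·⟩ = ± t` whose `l_1`- and `l_∞`-distances `t / ‖v‖_∞`, `t / ‖v‖_1` from the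
origin are at least `ρ₁` and `ρ_∞` is not met by a vector whose `l_p`-norm is below the bound. -/
lemma abs_dotProduct_lt {d : ℕ} {p q ρ₁ ρinf t : ℝ} (h : p.HolderConjugate q)
    {v δ : Fin d → ℝ} (hv : v ≠ 0) (hρ₁ : 0 < ρ₁) (hρinf : 0 < ρinf)
    (h₁ : ρ₁ ≤ t / lpNorm ⊤ v) (hinf : ρinf ≤ t / lpNorm 1 v)
    (hδ : lpNorm (ENNReal.ofReal p) δ <
      ρ₁ / (⌊ρ₁ / ρinf⌋ + Int.fract (ρ₁ / ρinf) ^ q) ^ (1 / q)) :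
    |v ⬝ᵥ δ| < t := by
  rw [le_div_iff₀ (lpNorm_top_pos hv)] at h₁
  rw [le_div_iff₀ (lpNorm_one_pos hv)] at hinf
  have ht : 0 < t := (mul_pos hρ₁ (lpNorm_top_pos hv)).trans_le h₁
  set F : ℝ := ⌊ρ₁ / ρinf⌋ + Int.fract (ρ₁ / ρinf) ^ q with hF
  have hF0 : 0 ≤ F :=
    add_nonneg (by exact_mod_cast Int.floor_nonneg.mpr (div_pos hρ₁ hρinf).le)
      (Real.rpow_nonneg (Int.fract_nonneg _) _)
  -- rescaled by `ρ₁ / t`, the coordinates of `v` lie in `[0, 1]`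
  have key : ∑ i, (ρ₁ / t * |v i|) ^ q ≤ F := by
    refine sum_rpow_le_floor_add_fract_rpow _ h.symm.lt.le _ (fun i => by positivity)
      (fun i => ?_) ?_
    · rw [div_mul_eq_mul_div, div_le_one ht]
      exact (mul_le_mul_of_nonneg_left (abs_le_lpNorm_top v i) hρ₁.le).trans h₁
    -- `∑ (ρ₁ / t) |v_i| = ρ₁ ‖v‖₁ / t ≤ ρ₁ / ρ_∞`
    · rw [← Finset.mul_sum, ← lpNorm_one, div_mul_eq_mul_div, div_le_div_iff₀ ht hρinf, mul_assoc,
        mul_comm (lpNorm 1 v)]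
      exact mul_le_mul_of_nonneg_left hinf hρ₁.le
  have hq : 0 < q := h.symm.pos
  have key2 : ρ₁ / t * (∑ i, |v i| ^ q) ^ (1 / q) ≤ F ^ (1 / q) := by
    refine le_trans (le_of_eq ?_) (Real.rpow_le_rpow
      (Finset.sum_nonneg fun i _ => by positivity) key (by positivity))
    have e : ∀ i, (ρ₁ / t * |v i|) ^ q = (ρ₁ / t) ^ q * |v i| ^ q := fun i =>
      Real.mul_rpow (by positivity) (abs_nonneg _)
    simp only [e]
    rw [← Finset.mul_sum, Real.mul_rpow (by positivity)
      (Finset.sum_nonneg fun i _ => by positivity), ← Real.rpow_mul (by positivity),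
      mul_one_div_cancel hq.ne', Real.rpow_one]
  have hδ0 : 0 ≤ lpNorm (ENNReal.ofReal p) δ := by
    rw [lpNorm_ofReal h.pos]; positivity
  have hFpos : 0 < F ^ (1 / q) := by
    refine lt_of_le_of_ne (Real.rpow_nonneg hF0 _) fun h0 => ?_
    -- as `r / 0 = 0`, the hypothesis on `δ` would make its norm negative
    rw [← h0, div_zero] at hδ
    exact absurd hδ0 (not_le.mpr hδ)
  rw [lt_div_iff₀ hFpos] at hδ
  have h3 : (∑ i, |v i| ^ q) ^ (1 / q) ≤ F ^ (1 / q) * t / ρ₁ := by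
    rw [le_div_iff₀ hρ₁]
    calc _ = (ρ₁ / t * (∑ i, |v i| ^ q) ^ (1 / q)) * t := by field_simp
      _ ≤ _ := mul_le_mul_of_nonneg_right key2 ht.le
  calc |v ⬝ᵥ δ| ≤ _ := abs_dotProduct_le_lpNorm_mul h v δ
    _ ≤ lpNorm (ENNReal.ofReal p) δ * (F ^ (1 / q) * t / ρ₁) :=
      mul_le_mul_of_nonneg_left h3 hδ0
    _ = (lpNorm (ENNReal.ofReal p) δ * F ^ (1 / q)) * (t / ρ₁) := by ring
    _ < ρ₁ * (t / ρ₁) := mul_lt_mul_of_pos_right hδ (by positivity)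
    _ = t := by field_simp

/-! ### The network on its linear region -/

lemma linPart_succ_mulVec_add (N : ReLUNetwork) (x z : Fin N.inputDim → ℝ) (l : ℕ) :
    N.linPart x (l + 1) *ᵥ z + N.constPart x (l + 1) =
      N.W (l + 1) *ᵥ (N.activePattern x l *ᵥ (N.linPart x l *ᵥ z + N.constPart x l)) +
        N.b (l + 1) := by
  simp only [linPart, constPart, Matrix.mulVec_add, ← Matrix.mulVec_mulVec, add_assoc]

lemma preAct_self (N : ReLUNetwork) (x : Fin N.inputDim → ℝ) (l : ℕ) :
    N.preAct x l = N.linPart x l *ᵥ x + N.constPart x l := by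
  induction l with
  | zero => rfl
  | succ l ih =>
    rw [linPart_succ_mulVec_add, ← ih, preAct]
    congr 2
    ext i
    rw [activePattern, Matrix.mulVec_diagonal]
    change max 0 (N.preAct x l i) = _
    split_ifs with h
    · rw [max_eq_right h.le, one_mul]
    · rw [max_eq_left (not_lt.mp h), zero_mul]

/-- As long as no hyperplane of an earlier layer is crossed, the pre-activations are given by the
affine map of the linear region of `x`. A hyperplane may be touched, and a unit with zero linear
part satisfies the hypothesis trivially. -/
lemma preAct_add_of_abs_dotProduct_le (N : ReLUNetwork) (x δ : Fin N.inputDim → ℝ) (l : ℕ)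
    (h : ∀ k < l, ∀ j, |N.linPart x k j ⬝ᵥ δ| ≤ |N.preAct x k j|) :
    N.preAct (x + δ) l = N.preAct x l + N.linPart x l *ᵥ δ := by
  have main : N.preAct (x + δ) l = N.linPart x l *ᵥ (x + δ) + N.constPart x l := by
    induction l with
    | zero => rfl
    | succ l ih =>
      have ih' := ih fun k hk => h k (hk.trans (Nat.lt_succ_self l))
      rw [linPart_succ_mulVec_add, ← ih', preAct]
      congr 2
      ext i
      rw [activePattern, Matrix.mulVec_diagonal]
      change max 0 (N.preAct (x + δ) l i) = _
      have e : N.preAct (x + δ) l i = N.preAct x l i + N.linPart x l i ⬝ᵥ δ := by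
        rw [ih', preAct_self, Matrix.mulVec_add]
        simp only [Pi.add_apply, Matrix.mulVec]
        ring
      have hi := h l (Nat.lt_succ_self l) i
      split_ifs with hpos
      · rw [abs_of_pos hpos] at hi
        rw [one_mul, max_eq_right]
        linarith [neg_abs_le (N.linPart x l i ⬝ᵥ δ)]
      · rw [abs_of_nonpos (not_lt.mp hpos)] at hi
        rw [zero_mul, max_eq_left]
        linarith [le_abs_self (N.linPart x l i ⬝ᵥ δ)]
  rw [main, preAct_self, Matrix.mulVec_add]
  abel

/-- A perturbation that meets no hyperplane of the linear region of `x` and no decision hyperplane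
keeps the class of `x`. -/
lemma not_misclassified (N : ReLUNetwork) {x δ : Fin N.inputDim → ℝ} {c : Fin N.numClasses}
    (hc : N.CorrectlyClassified x c)
    (hB : ∀ k < N.depth, ∀ j, N.linPart x k j ≠ 0 →
      |N.linPart x k j ⬝ᵥ δ| ≤ |N.preAct x k j|)
    (hD : ∀ s, s ≠ c → N.linPart x N.depth c ≠ N.linPart x N.depth s →
      |(N.linPart x N.depth c - N.linPart x N.depth s) ⬝ᵥ δ| < N.output x c - N.output x s) :
    ¬ ∃ s, s ≠ c ∧ N.output (x + δ) c ≤ N.output (x + δ) s := by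
  rintro ⟨s, hs, hle⟩
  have haff := N.preAct_add_of_abs_dotProduct_le x δ N.depth fun k hk j => by
    by_cases h0 : N.linPart x k j = 0
    · rw [h0, zero_dotProduct, abs_zero]
      exact abs_nonneg _
    · exact hB k hk j h0
  have happ : ∀ r, N.output (x + δ) r = N.output x r + N.linPart x N.depth r ⬝ᵥ δ := fun r =>
    congrFun haff r
  rw [happ, happ] at hle
  by_cases h0 : N.linPart x N.depth c = N.linPart x N.depth s
  · rw [h0] at hle
    linarith [hc s hs]
  · have h1 := hD s hs h0
    rw [sub_dotProduct] at h1
    linarith [neg_abs_le (N.linPart x N.depth c ⬝ᵥ δ - N.linPart x N.depth s ⬝ᵥ δ)]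

/-! ### The distances to the hyperplanes -/

lemma classDist_nonneg (N : ReLUNetwork) {p : ℝ≥0∞} {x : Fin N.inputDim → ℝ}
    {c s : Fin N.numClasses} (hc : N.CorrectlyClassified x c) (hs : s ≠ c)
    (hN : 0 ≤ lpNorm p.conjExponent (N.linPart x N.depth c - N.linPart x N.depth s)) :
    0 ≤ N.classDist p x c s :=
  div_nonneg (sub_nonneg.mpr (hc s hs).le) hN

lemma rho_le_unitDist (N : ReLUNetwork) {p : ℝ≥0∞} {x : Fin N.inputDim → ℝ}
    (c : Fin N.numClasses) {k : ℕ} (hk : k < N.depth) {j : Fin (N.width (k + 1))}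
    (hj : N.linPart x k j ≠ 0) : N.rho p x c ≤ ENNReal.ofReal (N.unitDist p x k j) :=
  (min_le_left _ _).trans <|
    iInf_le_of_le (⟨k, hk⟩ : Fin N.depth) <| iInf_le_of_le j <| iInf_le_of_le hj le_rfl

lemma rho_le_classDist (N : ReLUNetwork) {p : ℝ≥0∞} {x : Fin N.inputDim → ℝ}
    {c s : Fin N.numClasses} (hc : N.CorrectlyClassified x c)
    (hN : ∀ v : Fin N.inputDim → ℝ, 0 ≤ lpNorm p.conjExponent v) (hs : s ≠ c)
    (hV : N.linPart x N.depth c ≠ N.linPart x N.depth s) :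
    N.rho p x c ≤ ENNReal.ofReal (N.classDist p x c s) := by
  refine (min_le_right _ _).trans ?_
  -- the distances are nonnegative, so that the absolute value has no effect
  have h0 : 0 ≤ N.decisionDist p x c :=
    le_iInf fun r => le_iInf fun hr => le_iInf fun _ => by
      exact_mod_cast N.classDist_nonneg hc hr (hN _)
  have h1 : N.decisionDist p x c ≤ (N.classDist p x c s : ℝ) :=
    iInf_le_of_le s <| iInf_le_of_le hs <| iInf_le_of_le hV le_rfl
  generalize N.decisionDist p x c = e at h0 h1
  induction e with
  | bot => simp at h0
  | top => simp at h1
  | coe e =>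
    rw [EReal.abs_def, abs_of_nonneg (by exact_mod_cast h0)]
    exact ENNReal.ofReal_le_ofReal (by exact_mod_cast h1)

lemma robustness_eq_top_of_rho_eq_top (N : ReLUNetwork) {p : ℝ≥0∞} {x : Fin N.inputDim → ℝ}
    {c : Fin N.numClasses} (hc : N.CorrectlyClassified x c)
    (hN : ∀ v : Fin N.inputDim → ℝ, 0 ≤ lpNorm p.conjExponent v) (h : N.rho p x c = ⊤)
    (S : Set (Fin N.inputDim → ℝ)) (p' : ℝ≥0∞) : N.robustness S p' x c = ⊤ := by
  refine iInf_eq_top.mpr fun δ => iInf_eq_top.mpr fun _ => iInf_eq_top.mpr fun hmis =>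
    absurd hmis (N.not_misclassified hc (fun k hk j hj => ?_) fun s hs hV => ?_)
  · exact absurd (h ▸ N.rho_le_unitDist c hk hj) (by simp)
  · exact absurd (h ▸ N.rho_le_classDist hc hN hs hV) (by simp)

lemma lpNorm_conjExponent_one {d : ℕ} (v : Fin d → ℝ) :
    lpNorm (ENNReal.conjExponent 1) v = lpNorm ⊤ v := by
  rw [show ENNReal.conjExponent 1 = ⊤ by simp [ENNReal.conjExponent]]

lemma lpNorm_conjExponent_top {d : ℕ} (v : Fin d → ℝ) :
    lpNorm (ENNReal.conjExponent ⊤) v = lpNorm 1 v := by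
  rw [show ENNReal.conjExponent ⊤ = 1 by simp [ENNReal.conjExponent]]

end ReLUNetwork

open ReLUNetwork in
theorem mainTheorem3 (N : ReLUNetwork) (hd : 2 ≤ N.inputDim)
    (S : Set (Fin N.inputDim → ℝ)) (x : Fin N.inputDim → ℝ) (c : Fin N.numClasses)
    (hc : N.CorrectlyClassified x c) (p q : ℝ) (hp : 1 < p) (hpq : 1 / p + 1 / q = 1) :
    ((N.rho 1 x c = ⊤ ∨ N.rho ⊤ x c = ⊤) → N.robustness S (ENNReal.ofReal p) x c = ⊤) ∧
    (N.rho 1 x c ≠ ⊤ → N.rho ⊤ x c ≠ ⊤ →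
      ∀ ρ₁ ρinf α : ℝ,
        ρ₁ = (N.rho 1 x c).toReal → ρinf = (N.rho ⊤ x c).toReal →
        α = ρ₁ / ρinf - (⌊ρ₁ / ρinf⌋ : ℝ) →
          ENNReal.ofReal (ρ₁ / (ρ₁ / ρinf - α + α ^ q) ^ (1 / q)) ≤
            N.robustness S (ENNReal.ofReal p) x c) := by
  have hN1 : ∀ v : Fin N.inputDim → ℝ, 0 ≤ lpNorm (ENNReal.conjExponent 1) v := fun v => by
    rw [lpNorm_conjExponent_one]; exact norm_nonneg (WithLp.toLp ⊤ v)
  have hNtop : ∀ v : Fin N.inputDim → ℝ, 0 ≤ lpNorm (ENNReal.conjExponent ⊤) v := fun v => by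
    rw [lpNorm_conjExponent_top]; exact norm_nonneg (WithLp.toLp 1 v)
  refine ⟨?_, fun h1 htop ρ₁ ρinf α hρ₁ hρinf hα => ?_⟩
  · rintro (h | h)
    exacts [N.robustness_eq_top_of_rho_eq_top hc hN1 h S _,
      N.robustness_eq_top_of_rho_eq_top hc hNtop h S _]
  have hconj : p.HolderConjugate q :=
    Real.holderConjugate_iff.mpr ⟨hp, by simpa [one_div] using hpq⟩
  have hα' : ρ₁ / ρinf - α + α ^ q = ⌊ρ₁ / ρinf⌋ + Int.fract (ρ₁ / ρinf) ^ q := by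
    rw [hα, Int.fract]; ring
  rw [hα']
  have hρ₁0 : 0 ≤ ρ₁ := hρ₁ ▸ ENNReal.toReal_nonneg
  have hρinf0 : 0 ≤ ρinf := hρinf ▸ ENNReal.toReal_nonneg
  -- if one of the radii vanishes, the bound is `0` (by `0⁻¹ = 0` if it is `ρ_∞`)
  rcases hρ₁0.eq_or_lt with h0 | hρ₁pos
  · rw [← h0]; simp
  rcases hρinf0.eq_or_lt with h0 | hρinfpos
  · rw [← h0]; simp [hconj.symm.ne_zero]
  refine le_iInf fun δ => le_iInf fun _ => le_iInf fun hmis => ENNReal.ofReal_le_ofReal ?_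
  by_contra! hδ
  refine N.not_misclassified hc (fun k hk j hj => ?_) (fun s hs hV => ?_) hmis
  · have e : N.linPart x k j ⬝ᵥ x + N.constPart x k j = N.preAct x k j :=
      (congrFun (N.preAct_self x k) j).symm
    refine (abs_dotProduct_lt hconj hj hρ₁pos hρinfpos ?_ ?_ hδ).le
    · rw [hρ₁, ← lpNorm_conjExponent_one, ← e]
      exact ENNReal.toReal_le_of_le_ofReal (div_nonneg (abs_nonneg _) (hN1 _))
        (N.rho_le_unitDist c hk hj)
    · rw [hρinf, ← lpNorm_conjExponent_top, ← e]
      exact ENNReal.toReal_le_of_le_ofReal (div_nonneg (abs_nonneg _) (hNtop _))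
        (N.rho_le_unitDist c hk hj)
  · refine abs_dotProduct_lt hconj (sub_ne_zero.mpr hV) hρ₁pos hρinfpos ?_ ?_ hδ
    · rw [hρ₁, ← lpNorm_conjExponent_one]
      exact ENNReal.toReal_le_of_le_ofReal (N.classDist_nonneg hc hs (hN1 _))
        (N.rho_le_classDist hc hN1 hs hV)
    · rw [hρinf, ← lpNorm_conjExponent_top]
      exact ENNReal.toReal_le_of_le_ofReal (N.classDist_nonneg hc hs (hNtop _))
        (N.rho_le_classDist hc hNtop hs hV)
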